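/- Let $0<\alpha<1$, $0<\delta<1$, let $n\in\mathbb N$ with $n\ge 3$, and let $g:\mathbb R^n\to\mathbb R$ belong to $C^{0,\alpha}(\mathbb R^n)$ and satisfy, for some constant $C$, \[ |g(x)|\le C(1+|x|)^{-n-\delta}\quad\text{for all }x\in\mathbb R^n . \] Here $C^{k,\alpha}(\mathbb R^n)$ denotes the set of functions on $\mathbb R^n$ that have continuous derivatives up to order $k$ and all of whose derivatives $D^\sigma$ of order $|\sigma|=k$ are Hölder continuous on $\mathbb R^n$ with exponent $\alpha$, i.e. $|D^\sigma f(x)-D^\sigma f(y)|\le K|x-y|^\alpha$ for some constant $K$ and all $x,y\in\mathbb R^n$. Then the integral \[ U(x):=-\int_{\mathbb R^n}\frac{g(y)}{|x-y|^{n-2}}\,dy \] converges absolutely for every $x\in\mathbb R^n$, $U\in C^{2,\alpha}(\mathbb R^n)$, and there is a constant $C'$ such that for every multi-index $\sigma\in\mathbb N_0^n$ with $|\sigma|\le 2$ and every $x\in\mathbb R^n$, \[ |D^\sigma U(x)|\le C'(1+|x|)^{2-n-|\sigma|}. \] Moreover, if $g$ is axially symmetric, that is, invariant under all rotations of $\mathbb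 R^n$ about the $x_n$-axis, then so is $U$. -/

import Mathlib

open scoped NNReal

noncomputable section

/-- The partial derivative of `f` in the `i`-th coordinate direction. -/
def partialDeriv {n : ℕ} (i : Fin n) (f : EuclideanSpace ℝ (Fin n) → ℝ) :
    EuclideanSpace ℝ (Fin n) → ℝ :=
  fun x => lineDeriv ℝ f x (EuclideanSpace.single i 1)

/-- The derivative `D^σ f = ∂₁^σ₁ ⋯ ∂ₙ^σₙ f` for a multi-index `σ`. -/
def multiDeriv {n : ℕ} (σ : Fin n → ℕ) (f : EuclideanSpace ℝ (Fin n) → ℝ) :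
    EuclideanSpace ℝ (Fin n) → ℝ :=
  (List.finRange n).foldr (fun i h => (partialDeriv i)^[σ i] h) f

/-- `f ∈ C^{k,α}(ℝⁿ)`: `f` is `k` times continuously differentiable, and every derivative
`D^σ f` of order `|σ| = k` is (globally) Hölder continuous with exponent `α`. -/
def IsCHolder {n : ℕ} (k : ℕ) (α : ℝ≥0) (f : EuclideanSpace ℝ (Fin n) → ℝ) : Prop :=
  ContDiff ℝ k f ∧ ∀ σ : Fin n → ℕ, ∑ i, σ i = k → MemHolder α (multiDeriv σ f)

/-- The Newton potential `U(x) = -∫ g(y) |x - y|^{2-n} dy` of `g` on `ℝⁿ`, for `n ≥ 2`. -/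
def newtonPotential {n : ℕ} (g : EuclideanSpace ℝ (Fin n) → ℝ) :
    EuclideanSpace ℝ (Fin n) → ℝ :=
  fun x => -∫ y, g y / ‖x - y‖ ^ (n - 2)

/-- `R` is a rotation of `ℝⁿ` about the `xₙ`-axis: a linear isometry of determinant one that
fixes the last standard basis vector. -/
def IsAxialRotation {n : ℕ} (R : EuclideanSpace ℝ (Fin n) ≃ₗᵢ[ℝ] EuclideanSpace ℝ (Fin n)) :
    Prop :=
  LinearMap.det (R.toLinearEquiv : EuclideanSpace ℝ (Fin n) →ₗ[ℝ] EuclideanSpace ℝ (Fin n)) = 1 ∧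
    ∀ i : Fin n, (i : ℕ) + 1 = n →
      R (EuclideanSpace.single i (1 : ℝ)) = EuclideanSpace.single i (1 : ℝ)

/-- `u` is axially symmetric: invariant under all rotations about the `xₙ`-axis. -/
def AxiallySymmetric {n : ℕ} (u : EuclideanSpace ℝ (Fin n) → ℝ) : Prop :=
  ∀ R : EuclideanSpace ℝ (Fin n) ≃ₗᵢ[ℝ] EuclideanSpace ℝ (Fin n),
    IsAxialRotation R → ∀ x, u (R x) = u x

end

/-!
The proof replaces the singular integrals of the classical argument by an average over scales.
For a smooth radial bump `φ` supported in the unit ball, homogeneity gives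
`c ‖x‖ ^ (2 - n) = ∫₀^∞ s ^ (1 - n) φ (x / s) ds` with `0 < c < ∞`
(`integral_bumpProfile_div`, `bumpConst_pos`), so by Fubini the Newton potential is, up to the factor
`-1 / c`, the superposition `∫₀^∞ s ^ (1 - n) P_s φ (x) ds` of the averages
`P_s φ (x) = ∫ g y φ ((x - y) / s) dy` (`integrable_and_scalePotential_bumpProfile`). Each `P_s φ` is
smooth, and a derivative replaces `φ` by `fderiv φ` at the price of a factor `1 / s`. The potential
can therefore be differentiated twice under the integral over `s`, as long as that integral keeps
converging (`ScaleBound.hasFDerivAt_scalePotential`).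

Convergence and decay come from two bounds on `P_s`. Put `R = (1 + ‖x‖) / 2`. For every `s`, `P_s`
is at most a multiple of the `L¹` norm of `g`. For `s ≤ R`, the average only sees points `y` with
`1 + ‖y‖ ≥ R`, where `g` is `O(R ^ (-n))`, so `P_s` is `O(s ^ n R ^ (-n))`. For second derivatives
this would leave the divergent integral of `1 / s` near `0`. But the second derivative of the bump
has mean zero, so `g` may be replaced by `g - g x`. Interpolating the Hölder bound against the decay
`‖x‖ ^ (-n - δ)` (`exists_abs_sub_le_of_decay`) gives `O(s ^ (n + β) R ^ (-n - β))` for some `β > 0`.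
This is where the room `δ > 0` is used: it absorbs the loss due to the Hölder constant of `g` not
decaying at infinity. In all cases the integral over `s` is dominated by the explicit function
`twoScale`, whose integral is a multiple of a power of `R`.

For the Hölder continuity of the second derivatives at `x` and `y`, the scales `s ≤ ‖x - y‖` are
estimated by `P_s = O(s ^ (n + α))` and the scales `s > ‖x - y‖` by the mean value inequality. The
resulting majorant is again `twoScale`, now with `R = ‖x - y‖`
(`exists_norm_scalePotential_sub_le`).
-/

open MeasureTheory Set Module

open scoped ContDiff Topology

/-! ### The two-scale majorant -/

/-- The model bound `s ^ (γ - 1) R ^ (-p - γ)` for `s ≤ R` and `s ^ (-1 - p)` for `s > R`, for an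
integral over the scales `s > 0`. The two branches agree at `s = R`. -/
noncomputable def twoScale (R γ p s : ℝ) : ℝ :=
  if s ≤ R then s ^ (γ - 1) * R ^ (-p - γ) else s ^ (-1 - p)

theorem integrableOn_twoScale {R γ p : ℝ} (hR : 0 < R) (hγ : 0 < γ) (hp : 0 < p) :
    IntegrableOn (twoScale R γ p) (Ioi 0) ∧
      ∫ s in Ioi 0, twoScale R γ p s = (1 / γ + 1 / p) * R ^ (-p) := by
  have hle : EqOn (twoScale R γ p) (fun s => s ^ (γ - 1) * R ^ (-p - γ)) (Ioc 0 R) :=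
    fun s hs => if_pos hs.2
  have hgt : EqOn (twoScale R γ p) (fun s => s ^ (-1 - p)) (Ioi R) :=
    fun s hs => if_neg (not_le.2 hs)
  have hint1 : IntegrableOn (twoScale R γ p) (Ioc 0 R) := by
    refine IntegrableOn.congr_fun ?_ hle.symm measurableSet_Ioc
    have := (intervalIntegral.intervalIntegrable_rpow' (a := 0) (b := R)
      (show -1 < γ - 1 by linarith)).1
    exact Integrable.mul_const this _
  have hint2 : IntegrableOn (twoScale R γ p) (Ioi R) :=
    (integrableOn_Ioi_rpow_of_lt (by linarith) hR).congr_fun hgt.symm measurableSet_Ioi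
  have hsplit : Ioi (0 : ℝ) = Ioc 0 R ∪ Ioi R := (Ioc_union_Ioi_eq_Ioi hR.le).symm
  refine ⟨by rw [hsplit]; exact hint1.union hint2, ?_⟩
  rw [hsplit, setIntegral_union (Ioc_disjoint_Ioi le_rfl) measurableSet_Ioi hint1 hint2,
    setIntegral_congr_fun measurableSet_Ioc hle, setIntegral_congr_fun measurableSet_Ioi hgt,
    integral_Ioi_rpow_of_lt (by linarith) hR, integral_mul_const,
    ← intervalIntegral.integral_of_le hR.le, integral_rpow (Or.inl (by linarith)),
    sub_add_cancel, Real.zero_rpow hγ.ne', show -1 - p + 1 = -p by ring,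
    show -p - γ = -p + -γ by ring, Real.rpow_add hR, Real.rpow_neg hR.le γ]
  have := Real.rpow_pos_of_pos hR γ
  field_simp
  ring

/-- A function of the scale that is dominated by the two-scale majorant with parameters
`R`, `γ`, `p` is integrable, with integral at most a multiple of `R ^ (-p)`. -/
theorem integrableOn_and_norm_integral_le_of_twoScale {F : Type*} [NormedAddCommGroup F]
    [NormedSpace ℝ F] {f : ℝ → F} {A R γ p : ℝ}
    (hf : AEStronglyMeasurable f (volume.restrict (Ioi 0)))
    (hR : 0 < R) (hγ : 0 < γ) (hp : 0 < p)
    (h : ∀ s, 0 < s → ‖f s‖ ≤ A * twoScale R γ p s) :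
    IntegrableOn f (Ioi 0) ∧ ‖∫ s in Ioi 0, f s‖ ≤ A * (1 / γ + 1 / p) * R ^ (-p) := by
  obtain ⟨hint, hval⟩ := integrableOn_twoScale hR hγ hp
  have hae : ∀ᵐ s ∂(volume.restrict (Ioi (0 : ℝ))), ‖f s‖ ≤ A * twoScale R γ p s :=
    (ae_restrict_iff' measurableSet_Ioi).2 (.of_forall h)
  refine ⟨(hint.const_mul A).mono' hf hae, ?_⟩
  refine (norm_integral_le_of_norm_le (hint.const_mul A) hae).trans_eq ?_
  rw [integral_const_mul, hval, mul_assoc]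

/-! ### Averages of a function against dilated bumps -/

/-- A smooth function vanishing outside the closed unit ball. -/
structure IsUnitBump {E : Type*} [NormedAddCommGroup E] [NormedSpace ℝ E] {F : Type*}
    [NormedAddCommGroup F] [NormedSpace ℝ F] (φ : E → F) : Prop where
  contDiff : ContDiff ℝ ∞ φ
  eq_zero : ∀ z, 1 < ‖z‖ → φ z = 0

namespace IsUnitBump

variable {E : Type*} [NormedAddCommGroup E] [NormedSpace ℝ E] {F : Type*}
  [NormedAddCommGroup F] [NormedSpace ℝ F] {φ : E → F}

theorem fderiv (hφ : IsUnitBump φ) : IsUnitBump (fderiv ℝ φ) where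
  contDiff := hφ.contDiff.fderiv_right (by simp)
  eq_zero z hz := by
    have h : φ =ᶠ[𝓝 z] fun _ => 0 := by
      filter_upwards [(isOpen_lt continuous_const continuous_norm).mem_nhds hz] with w hw
      exact hφ.eq_zero w hw
    rw [h.fderiv_eq, fderiv_fun_const]
    rfl

theorem hasCompactSupport [FiniteDimensional ℝ E] (hφ : IsUnitBump φ) : HasCompactSupport φ :=
  HasCompactSupport.intro (isCompact_closedBall (0 : E) 1) fun z hz =>
    hφ.eq_zero z (by simpa using hz)

theorem exists_norm_le [FiniteDimensional ℝ E] (hφ : IsUnitBump φ) : ∃ M, 0 ≤ M ∧ ∀ z, ‖φ z‖ ≤ M := by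
  obtain ⟨M, hM⟩ := hφ.hasCompactSupport.exists_bound_of_continuous hφ.contDiff.continuous
  exact ⟨M, (norm_nonneg _).trans (hM 0), hM⟩

theorem dilate_eq_zero (hφ : IsUnitBump φ) {s : ℝ} (hs : 0 < s) {z : E} (hz : s < ‖z‖) :
    φ (s⁻¹ • z) = 0 := by
  apply hφ.eq_zero
  rw [norm_smul, norm_inv, Real.norm_of_nonneg hs.le, ← div_eq_inv_mul, one_lt_div hs]
  exact hz

end IsUnitBump

section

variable {E : Type*} [NormedAddCommGroup E] [InnerProductSpace ℝ E] [FiniteDimensional ℝ E]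
  [MeasurableSpace E] [BorelSpace E] {F : Type*} [NormedAddCommGroup F] [NormedSpace ℝ F]

/-- The (unnormalised) average of `g` around `x` at scale `s`, weighted by the bump `φ`. -/
noncomputable def scaleAverage (g : E → ℝ) (φ : E → F) (s : ℝ) (x : E) : F :=
  ∫ y, g y • φ (s⁻¹ • (x - y))

variable {g : E → ℝ} {φ : E → F}

theorem stronglyMeasurable_scaleAverage_integrand (hg : Continuous g) (hφ : IsUnitBump φ)
    (x : E) : StronglyMeasurable fun z : ℝ × E => g z.2 • φ (z.1⁻¹ • (x - z.2)) := by
  refine (hg.stronglyMeasurable.comp_measurable measurable_snd).smul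
    (hφ.contDiff.continuous.stronglyMeasurable.comp_measurable ?_)
  exact measurable_fst.inv.smul (measurable_const.sub measurable_snd)

theorem stronglyMeasurable_scaleAverage (hg : Continuous g) (hφ : IsUnitBump φ) (x : E) :
    StronglyMeasurable fun s => scaleAverage g φ s x :=
  (stronglyMeasurable_scaleAverage_integrand hg hφ x).integral_prod_right'

theorem norm_scaleAverage_le {s A M : ℝ} {x : E} (hs : 0 < s) (hφ : IsUnitBump φ)
    (hM : ∀ z, ‖φ z‖ ≤ M) (hA : ∀ y, ‖x - y‖ ≤ s → |g y| ≤ A) :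
    ‖scaleAverage g φ s x‖ ≤ A * M * (s ^ finrank ℝ E * volume.real (Metric.ball (0 : E) 1)) := by
  rw [← Measure.addHaar_real_closedBall _ x hs.le, mul_comm, ← smul_eq_mul,
    ← setIntegral_const, ← integral_indicator Metric.isClosed_closedBall.measurableSet]
  refine norm_integral_le_of_norm_le ?_ (.of_forall fun y => ?_)
  · exact (integrable_indicator_iff Metric.isClosed_closedBall.measurableSet).2
      (integrableOn_const (isCompact_closedBall x s).measure_lt_top.ne)
  · by_cases hy : ‖x - y‖ ≤ s
    · rw [indicator_of_mem (by rwa [Metric.mem_closedBall', dist_eq_norm]), norm_smul]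
      exact mul_le_mul (hA y hy) (hM _) (norm_nonneg _) ((abs_nonneg _).trans (hA y hy))
    · rw [hφ.dilate_eq_zero hs (not_le.1 hy), smul_zero, norm_zero]
      refine indicator_nonneg (fun y' _ => ?_) y
      exact mul_nonneg ((abs_nonneg _).trans (hA x (by simpa using hs.le)))
        ((norm_nonneg _).trans (hM 0))

theorem norm_scaleAverage_le_integral {s M : ℝ} {x : E} (hg : Integrable g)
    (hM : ∀ z, ‖φ z‖ ≤ M) : ‖scaleAverage g φ s x‖ ≤ (∫ y, |g y|) * M := by
  rw [← integral_mul_const]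
  refine norm_integral_le_of_norm_le (hg.norm.mul_const M) (.of_forall fun y => ?_)
  rw [norm_smul]
  exact mul_le_mul_of_nonneg_left (hM _) (norm_nonneg _)

theorem integrable_scaleAverage_integrand (hg : Continuous g) (hφ : IsUnitBump φ) {s : ℝ}
    (hs : 0 < s) (x : E) : Integrable fun y => g y • φ (s⁻¹ • (x - y)) := by
  refine Continuous.integrable_of_hasCompactSupport ?_ ?_
  · have := hφ.contDiff.continuous
    fun_prop
  · refine HasCompactSupport.intro (isCompact_closedBall x s) fun y hy => ?_
    rw [Metric.mem_closedBall', dist_eq_norm, not_le] at hy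
    rw [hφ.dilate_eq_zero hs hy, smul_zero]

theorem hasFDerivAt_scaleAverage (hg : Continuous g) (hφ : IsUnitBump φ) {s : ℝ} (hs : 0 < s)
    (x : E) : HasFDerivAt (scaleAverage g φ s) (s⁻¹ • scaleAverage g (fderiv ℝ φ) s x) x := by
  have hd (z : E) : HasFDerivAt (fun w => φ (s⁻¹ • w)) (s⁻¹ • fderiv ℝ φ (s⁻¹ • z)) z := by
    have h1 : HasFDerivAt φ (fderiv ℝ φ (s⁻¹ • z)) (s⁻¹ • z) :=
      (hφ.contDiff.differentiable (by simp) _).hasFDerivAt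
    have h2 : HasFDerivAt (fun w : E => s⁻¹ • w) (s⁻¹ • ContinuousLinearMap.id ℝ E) z :=
      (hasFDerivAt_id z).const_smul s⁻¹
    refine (h1.comp z h2).congr_fderiv ?_
    rw [ContinuousLinearMap.comp_smul, ContinuousLinearMap.comp_id]
  have hcs : HasCompactSupport fun w => φ (s⁻¹ • w) :=
    HasCompactSupport.intro (isCompact_closedBall (0 : E) s) fun z hz =>
      hφ.dilate_eq_zero hs (by simpa using hz)
  have hcd : ContDiff ℝ 1 fun w => φ (s⁻¹ • w) :=
    (hφ.contDiff.of_le (by simp)).comp (contDiff_const_smul s⁻¹)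
  have key := hcs.hasFDerivAt_convolution_right (ContinuousLinearMap.lsmul ℝ ℝ)
    (hg.locallyIntegrable (μ := volume)) hcd x
  refine HasFDerivAt.congr_fderiv (f := scaleAverage g φ s) key ?_
  unfold scaleAverage convolution
  rw [← integral_smul]
  refine integral_congr_ae (.of_forall fun y => ?_)
  simp only [(hd _).fderiv]
  ext v
  exact smul_comm _ _ _

theorem scaleAverage_sub (hg : Continuous g) (hφ : IsUnitBump φ) (h0 : ∫ z, φ z = 0) {s : ℝ}
    (hs : 0 < s) (x : E) (a : ℝ) :
    scaleAverage (fun y => g y - a) φ s x = scaleAverage g φ s x := by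
  have h1 : ∫ y, a • φ (s⁻¹ • (x - y)) = 0 := by
    rw [integral_smul, integral_sub_left_eq_self (fun y => φ (s⁻¹ • y)),
      Measure.integral_comp_inv_smul, h0, smul_zero, smul_zero]
  simp only [scaleAverage, sub_smul]
  rw [integral_sub (integrable_scaleAverage_integrand hg hφ hs x)
    (integrable_scaleAverage_integrand continuous_const hφ hs x), h1, sub_zero]

/-- The derivative of a bump has mean zero: averages of the constant `1` against the bump do not
depend on the point. -/
theorem integral_fderiv_eq_zero (hφ : IsUnitBump φ) : ∫ z, fderiv ℝ φ z = 0 := by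
  have h1 := hasFDerivAt_scaleAverage (g := fun _ : E => 1) continuous_const hφ one_pos (0 : E)
  have h2 : scaleAverage (fun _ : E => 1) φ 1 = fun _ => ∫ z, φ z := by
    funext x
    simp only [scaleAverage, one_smul, inv_one]
    exact integral_sub_left_eq_self φ volume x
  rw [h2] at h1
  have h3 := h1.unique (hasFDerivAt_const _ _)
  simp only [scaleAverage, one_smul, inv_one] at h3
  rwa [integral_sub_left_eq_self (fderiv ℝ φ)] at h3

/-! ### Superpositions of averages over all scales -/

/-- The superposition `∫₀^∞ s ^ (-q) (g ∗ φ(·/s))(x) ds` of the averages of `g` over all scales. -/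
noncomputable def scalePotential (g : E → ℝ) (q : ℝ) (φ : E → F) (x : E) : F :=
  ∫ s in Ioi (0 : ℝ), s ^ (-q) • scaleAverage g φ s x

/-- Bounds on the averages of `g` that make the scale integral with weight `s ^ (-q)` converge and
decay like `(1 + ‖x‖) ^ (1 - q)`. Scales below `(1 + ‖x‖) / 2` only see values of `g` far away
from the origin, and gain a power `γ` of the scale over the critical one. -/
structure ScaleBound (g : E → ℝ) (φ : E → F) (q γ A : ℝ) : Prop where
  near : ∀ x s, 0 < s → s ≤ (1 + ‖x‖) / 2 →
    ‖scaleAverage g φ s x‖ ≤ A * (s ^ (q + γ - 1) * ((1 + ‖x‖) / 2) ^ (1 - q - γ))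
  far : ∀ x s, 0 < s → ‖scaleAverage g φ s x‖ ≤ A

theorem aestronglyMeasurable_scalePotential_integrand (hg : Continuous g) (hφ : IsUnitBump φ)
    (q : ℝ) (x : E) : AEStronglyMeasurable (fun s : ℝ => s ^ (-q) • scaleAverage g φ s x)
      (volume.restrict (Ioi 0)) := by
  refine StronglyMeasurable.aestronglyMeasurable ?_
  exact (Measurable.stronglyMeasurable (by fun_prop)).smul
    (stronglyMeasurable_scaleAverage hg hφ x)

namespace ScaleBound

variable {q γ A : ℝ}

theorem nonneg (h : ScaleBound g φ q γ A) : 0 ≤ A :=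
  (norm_nonneg _).trans (h.far 0 1 one_pos)

theorem norm_le_twoScale (h : ScaleBound g φ q γ A) {x : E} {R : ℝ} (hR : 0 < R)
    (hRx : R ≤ (1 + ‖x‖) / 2) (hqγ : 0 ≤ q - 1 + γ) {s : ℝ} (hs : 0 < s) :
    ‖s ^ (-q) • scaleAverage g φ s x‖ ≤ A * twoScale R γ (q - 1) s := by
  rw [norm_smul, Real.norm_of_nonneg (Real.rpow_nonneg hs.le _), twoScale]
  split_ifs with hsR
  · calc s ^ (-q) * ‖scaleAverage g φ s x‖
        ≤ s ^ (-q) * (A * (s ^ (q + γ - 1) * R ^ (1 - q - γ))) := by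
          refine mul_le_mul_of_nonneg_left ((h.near x s hs (hsR.trans hRx)).trans ?_)
            (Real.rpow_nonneg hs.le _)
          have := Real.rpow_le_rpow_of_nonpos hR hRx (show 1 - q - γ ≤ 0 by linarith)
          have := h.nonneg
          gcongr
      _ = A * (s ^ (γ - 1) * R ^ (-(q - 1) - γ)) := by
          rw [show γ - 1 = -q + (q + γ - 1) by ring, Real.rpow_add hs,
            show -(q - 1) - γ = 1 - q - γ by ring]
          ring
  · rw [show -1 - (q - 1) = -q by ring, mul_comm]
    exact mul_le_mul_of_nonneg_right (h.far x s hs) (Real.rpow_nonneg hs.le _)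

theorem integrableOn (h : ScaleBound g φ q γ A) (hg : Continuous g) (hφ : IsUnitBump φ)
    (hq : 1 < q) (hγ : 0 < γ) (x : E) :
    IntegrableOn (fun s : ℝ => s ^ (-q) • scaleAverage g φ s x) (Ioi 0) :=
  (integrableOn_and_norm_integral_le_of_twoScale
    (aestronglyMeasurable_scalePotential_integrand hg hφ q x)
    (R := (1 + ‖x‖) / 2) (by positivity) hγ (sub_pos.2 hq)
    fun _ hs => h.norm_le_twoScale (by positivity) le_rfl (by linarith) hs).1

theorem exists_norm_scalePotential_le (h : ScaleBound g φ q γ A) (hg : Continuous g)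
    (hφ : IsUnitBump φ) (hq : 1 < q) (hγ : 0 < γ) :
    ∃ B, ∀ x, ‖scalePotential g q φ x‖ ≤ B * (1 + ‖x‖) ^ (1 - q) := by
  refine ⟨A * (1 / γ + 1 / (q - 1)) * 2⁻¹ ^ (1 - q), fun x => ?_⟩
  refine (integrableOn_and_norm_integral_le_of_twoScale
    (aestronglyMeasurable_scalePotential_integrand hg hφ q x)
    (R := (1 + ‖x‖) / 2) (by positivity) hγ (sub_pos.2 hq)
    fun _ hs => h.norm_le_twoScale (by positivity) le_rfl (by linarith) hs).2.trans_eq ?_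
  rw [div_eq_mul_inv (1 + ‖x‖), Real.mul_rpow (by positivity) (by norm_num), neg_sub]
  ring

/-- Differentiation under the integral over the scales: each derivative costs one power of the
scale and moves onto the bump. -/
theorem hasFDerivAt_scalePotential {γ' A' : ℝ} (h : ScaleBound g φ q γ A)
    (h' : ScaleBound g (fderiv ℝ φ) (q + 1) γ' A') (hg : Continuous g) (hφ : IsUnitBump φ)
    (hq : 1 < q) (hγ : 0 < γ) (hγ' : 0 < γ') (x : E) :
    HasFDerivAt (scalePotential g q φ) (scalePotential g (q + 1) (fderiv ℝ φ) x) x := by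
  refine hasFDerivAt_integral_of_dominated_of_fderiv_le
    (F := fun x s => s ^ (-q) • scaleAverage g φ s x)
    (F' := fun x s => s ^ (-(q + 1)) • scaleAverage g (fderiv ℝ φ) s x)
    (bound := fun s => A' * twoScale (1 / 2) γ' (q + 1 - 1) s) (s := univ) Filter.univ_mem
    (.of_forall fun x => aestronglyMeasurable_scalePotential_integrand hg hφ q x)
    (h.integrableOn hg hφ hq hγ x)
    (aestronglyMeasurable_scalePotential_integrand hg hφ.fderiv _ x) ?_ ?_ ?_
  · refine (ae_restrict_iff' measurableSet_Ioi).2 (.of_forall fun s hs y _ => ?_)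
    exact h'.norm_le_twoScale (by norm_num) (by linarith [norm_nonneg y]) (by linarith) hs
  · exact (integrableOn_twoScale (by norm_num) hγ' (by linarith)).1.const_mul _
  · refine (ae_restrict_iff' measurableSet_Ioi).2 (.of_forall fun s (hs : 0 < s) y _ => ?_)
    refine ((hasFDerivAt_scaleAverage hg hφ hs y).const_smul (s ^ (-q))).congr_fderiv ?_
    rw [smul_smul, neg_add, Real.rpow_add hs, Real.rpow_neg_one]

end ScaleBound

/-- If averages at scale `s` are `O(s ^ (q - 1 + α))`, for the bump and for its derivative, the
scale integral with weight `s ^ (-q)` is `α`-Hölder: for the difference of its values at `x` and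
`y`, scales below `‖x - y‖` are estimated trivially, larger ones by the mean value inequality. -/
theorem exists_norm_scalePotential_sub_le {q α A : ℝ} (hg : Continuous g) (hφ : IsUnitBump φ)
    (hα0 : 0 < α) (hα1 : α < 1)
    (h : ∀ x s, 0 < s → ‖scaleAverage g φ s x‖ ≤ A * s ^ (q - 1 + α))
    (h' : ∀ x s, 0 < s → ‖scaleAverage g (fderiv ℝ φ) s x‖ ≤ A * s ^ (q - 1 + α))
    (hint : ∀ x, IntegrableOn (fun s : ℝ => s ^ (-q) • scaleAverage g φ s x) (Ioi 0)) :
    ∃ B, 0 ≤ B ∧ ∀ x y, ‖scalePotential g q φ x - scalePotential g q φ y‖ ≤ B * ‖x - y‖ ^ α := by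
  have hA : 0 ≤ A := by simpa using (norm_nonneg _).trans (h 0 1 one_pos)
  have hα1' : 0 < 1 - α := sub_pos.2 hα1
  refine ⟨2 * A * (1 / α + 1 / (1 - α)), by positivity, fun x y => ?_⟩
  rcases eq_or_ne x y with rfl | hxy
  · simp [Real.zero_rpow hα0.ne']
  have hr : 0 < ‖x - y‖ := norm_pos_iff.2 (sub_ne_zero.2 hxy)
  set r := ‖x - y‖
  have hsub : scalePotential g q φ x - scalePotential g q φ y = ∫ s in Ioi (0 : ℝ),
      (s ^ (-q) • scaleAverage g φ s x - s ^ (-q) • scaleAverage g φ s y) :=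
    (integral_sub (hint x) (hint y)).symm
  rw [hsub]
  refine (integrableOn_and_norm_integral_le_of_twoScale (A := 2 * A * r)
    ((aestronglyMeasurable_scalePotential_integrand hg hφ q x).sub
    (aestronglyMeasurable_scalePotential_integrand hg hφ q y)) hr hα0 hα1'
    fun s hs => ?_).2.trans_eq ?_
  · rw [Pi.sub_apply, ← smul_sub, norm_smul, Real.norm_of_nonneg (Real.rpow_nonneg hs.le _),
      twoScale]
    split_ifs with hsr
    · calc s ^ (-q) * ‖scaleAverage g φ s x - scaleAverage g φ s y‖
          ≤ s ^ (-q) * (A * s ^ (q - 1 + α) + A * s ^ (q - 1 + α)) :=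
            mul_le_mul_of_nonneg_left
              ((norm_sub_le _ _).trans (add_le_add (h x s hs) (h y s hs)))
              (Real.rpow_nonneg hs.le _)
        _ = 2 * A * r * (s ^ (α - 1) * r ^ (-(1 - α) - α)) := by
            rw [show α - 1 = -q + (q - 1 + α) by ring, Real.rpow_add hs (-q),
              show -(1 - α) - α = -1 by ring, Real.rpow_neg_one]
            field_simp
            ring
    · have hmv : ‖scaleAverage g φ s x - scaleAverage g φ s y‖
          ≤ s⁻¹ * (A * s ^ (q - 1 + α)) * r := by
        refine convex_univ.norm_image_sub_le_of_norm_hasFDerivWithin_le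
          (fun z _ => (hasFDerivAt_scaleAverage hg hφ hs z).hasFDerivWithinAt)
          (fun z _ => ?_) (mem_univ y) (mem_univ x)
        rw [norm_smul, norm_inv, Real.norm_of_nonneg hs.le]
        exact mul_le_mul_of_nonneg_left (h' z s hs) (by positivity)
      calc s ^ (-q) * ‖scaleAverage g φ s x - scaleAverage g φ s y‖
          ≤ s ^ (-q) * (s⁻¹ * (A * s ^ (q - 1 + α)) * r) :=
            mul_le_mul_of_nonneg_left hmv (Real.rpow_nonneg hs.le _)
        _ = A * r * s ^ (-1 - (1 - α)) := by
            rw [show -1 - (1 - α) = -q + -1 + (q - 1 + α) by ring,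
              Real.rpow_add hs (-q + -1), Real.rpow_add hs (-q), Real.rpow_neg_one]
            ring
        _ ≤ 2 * A * r * s ^ (-1 - (1 - α)) := by
            have := Real.rpow_nonneg hs.le (-1 - (1 - α))
            gcongr
            linarith
  · rw [show -(1 - α) = α + -1 by ring, Real.rpow_add hr, Real.rpow_neg_one]
    field_simp

/-! ### Bounds on averages of a decaying Hölder function -/

/-- For a Hölder function that decays faster than `‖x‖ ^ (-n)`, interpolation between the Hölder
bound and the decay gives a local Hölder bound, with a smaller exponent `β`, that still decays at
the scale-invariant rate `‖x‖ ^ (-n - β)`. -/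
theorem exists_abs_sub_le_of_decay {E : Type*} [NormedAddCommGroup E] {g : E → ℝ}
    {n α δ C K : ℝ} (hn : 0 ≤ n) (hα : 0 < α) (hδ : 0 < δ)
    (hC : ∀ x, |g x| ≤ C * (1 + ‖x‖) ^ (-n - δ)) (hK : ∀ x y, |g x - g y| ≤ K * ‖x - y‖ ^ α) :
    ∃ β A, 0 < β ∧ 0 ≤ A ∧ ∀ x y, ‖x - y‖ ≤ (1 + ‖x‖) / 2 →
      |g y - g x| ≤ A * (‖x - y‖ ^ β * ((1 + ‖x‖) / 2) ^ (-n - β)) := by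
  have hC0 : 0 ≤ C := by simpa using (abs_nonneg _).trans (hC 0)
  -- This weight makes the two decay exponents match: `(n + δ) (1 - θ) = n + α θ`.
  set θ := δ / (n + δ + α)
  have hθ0 : 0 < θ := by positivity
  have hθ1 : 0 ≤ 1 - θ := by
    rw [sub_nonneg, div_le_one (by positivity)]
    linarith
  have hθ : (-n - δ) * (1 - θ) = -n - α * θ := by
    simp only [θ]
    field_simp
    ring
  refine ⟨α * θ, |K| ^ θ * (2 * C) ^ (1 - θ), by positivity, by positivity, fun x y hxy => ?_⟩
  set R := (1 + ‖x‖) / 2 with hRdef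
  have hR : 0 < R := by positivity
  have hdec (z : E) (hz : R ≤ 1 + ‖z‖) : |g z| ≤ C * R ^ (-n - δ) :=
    (hC z).trans (mul_le_mul_of_nonneg_left
      (Real.rpow_le_rpow_of_nonpos hR hz (by linarith)) hC0)
  have h1 : |g y - g x| ≤ |K| * ‖x - y‖ ^ α := by
    rw [abs_sub_comm]
    exact (hK x y).trans (mul_le_mul_of_nonneg_right (le_abs_self K) (by positivity))
  have h2 : |g y - g x| ≤ 2 * C * R ^ (-n - δ) := by
    have hy : R ≤ 1 + ‖y‖ := by
      have := norm_sub_norm_le x y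
      linarith
    have hx : R ≤ 1 + ‖x‖ := by linarith [norm_nonneg x]
    linarith [abs_sub (g y) (g x), hdec x hx, hdec y hy]
  calc |g y - g x| = |g y - g x| ^ θ * |g y - g x| ^ (1 - θ) := by
        rw [← Real.rpow_add_of_nonneg (abs_nonneg _) hθ0.le hθ1, add_sub_cancel, Real.rpow_one]
    _ ≤ (|K| * ‖x - y‖ ^ α) ^ θ * (2 * C * R ^ (-n - δ)) ^ (1 - θ) := by gcongr
    _ = _ := by
        rw [Real.mul_rpow (by positivity) (by positivity),
          Real.mul_rpow (by positivity) (by positivity), ← Real.rpow_mul (norm_nonneg _),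
          ← Real.rpow_mul hR.le, hθ]
        ring

theorem integrable_of_decay {δ C : ℝ} (hg : Continuous g) (hδ : 0 < δ)
    (hC : ∀ x, |g x| ≤ C * (1 + ‖x‖) ^ (-(finrank ℝ E : ℝ) - δ)) : Integrable g := by
  have := (integrable_one_add_norm (μ := (volume : Measure E)) (r := finrank ℝ E + δ)
    (by linarith)).const_mul C
  refine this.mono' hg.aestronglyMeasurable (.of_forall fun x => ?_)
  rw [neg_add']
  exact hC x

/-- Averages against an arbitrary bump, used for the potential (`k = 0`) and its first derivatives
(`k = 1`). -/
theorem exists_scaleBound_of_decay {δ C : ℝ} (hg : Continuous g) (hδ : 0 < δ)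
    (hC : ∀ x, |g x| ≤ C * (1 + ‖x‖) ^ (-(finrank ℝ E : ℝ) - δ)) (hφ : IsUnitBump φ)
    {q γ : ℝ} (hqγ : q + γ - 1 = finrank ℝ E) : ∃ A, ScaleBound g φ q γ A := by
  have hC0 : 0 ≤ C := by simpa using (abs_nonneg _).trans (hC 0)
  obtain ⟨M, hM0, hM⟩ := hφ.exists_norm_le
  refine ⟨max (C * M * volume.real (Metric.ball (0 : E) 1)) ((∫ y, |g y|) * M),
    fun x s hs hsR => ?_, fun x s hs => ?_⟩
  · set R := (1 + ‖x‖) / 2 with hRdef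
    have hR : 0 < R := by positivity
    refine (norm_scaleAverage_le (A := C * R ^ (-(finrank ℝ E : ℝ))) hs hφ hM
      fun y hy => ?_).trans ?_
    · refine (hC y).trans (mul_le_mul_of_nonneg_left ?_ hC0)
      have hy1 : R ≤ 1 + ‖y‖ := by
        have := norm_sub_norm_le x y
        linarith
      calc (1 + ‖y‖) ^ (-(finrank ℝ E : ℝ) - δ) ≤ (1 + ‖y‖) ^ (-(finrank ℝ E : ℝ)) :=
            Real.rpow_le_rpow_of_exponent_le (by linarith [norm_nonneg y]) (by linarith)
        _ ≤ R ^ (-(finrank ℝ E : ℝ)) := Real.rpow_le_rpow_of_nonpos hR hy1 (by simp)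
    · rw [hqγ, Real.rpow_natCast, show 1 - q - γ = -(finrank ℝ E : ℝ) by linarith]
      calc _ = C * M * volume.real (Metric.ball (0 : E) 1) *
            (s ^ finrank ℝ E * R ^ (-(finrank ℝ E : ℝ))) := by ring
        _ ≤ _ := mul_le_mul_of_nonneg_right (le_max_left _ _) (by positivity)
  · exact (norm_scaleAverage_le_integral (integrable_of_decay hg hδ hC) hM).trans
      (le_max_right _ _)

/-- Averages against a bump of mean zero, used for the second derivatives. -/
theorem exists_scaleBound_of_decay_of_integral_eq_zero {α δ C K : ℝ} (hg : Continuous g)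
    (hα : 0 < α) (hδ : 0 < δ) (hC : ∀ x, |g x| ≤ C * (1 + ‖x‖) ^ (-(finrank ℝ E : ℝ) - δ))
    (hK : ∀ x y, |g x - g y| ≤ K * ‖x - y‖ ^ α) (hφ : IsUnitBump φ) (h0 : ∫ z, φ z = 0) :
    ∃ γ A, 0 < γ ∧ ScaleBound g φ (finrank ℝ E + 1) γ A := by
  obtain ⟨M, hM0, hM⟩ := hφ.exists_norm_le
  obtain ⟨β, A, hβ, hA, hgA⟩ := exists_abs_sub_le_of_decay (Nat.cast_nonneg _) hα hδ hC hK
  refine ⟨β, max (A * M * volume.real (Metric.ball (0 : E) 1)) ((∫ y, |g y|) * M), hβ,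
    fun x s hs hsR => ?_, fun x s hs => ?_⟩
  · set R := (1 + ‖x‖) / 2 with hRdef
    have hR : 0 < R := by positivity
    rw [← scaleAverage_sub hg hφ h0 hs x (g x)]
    refine (norm_scaleAverage_le (A := A * (s ^ β * R ^ (-(finrank ℝ E : ℝ) - β))) hs hφ hM
      fun y hy => (hgA x y (hy.trans hsR)).trans ?_).trans ?_
    · gcongr
    · rw [show (finrank ℝ E : ℝ) + 1 + β - 1 = finrank ℝ E + β by ring, Real.rpow_add hs,
        Real.rpow_natCast, show 1 - ((finrank ℝ E : ℝ) + 1) - β = -(finrank ℝ E : ℝ) - β by ring]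
      calc _ = A * M * volume.real (Metric.ball (0 : E) 1) *
            (s ^ finrank ℝ E * s ^ β * R ^ (-(finrank ℝ E : ℝ) - β)) := by ring
        _ ≤ _ := mul_le_mul_of_nonneg_right (le_max_left _ _) (by positivity)
  · exact (norm_scaleAverage_le_integral (integrable_of_decay hg hδ hC) hM).trans
      (le_max_right _ _)

theorem exists_norm_scaleAverage_le_of_holder {α K : ℝ} (hg : Continuous g) (hα : 0 ≤ α)
    (hK : ∀ x y, |g x - g y| ≤ K * ‖x - y‖ ^ α) (hφ : IsUnitBump φ) (h0 : ∫ z, φ z = 0) :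
    ∃ A, ∀ x s, 0 < s → ‖scaleAverage g φ s x‖ ≤ A * s ^ (finrank ℝ E + α) := by
  obtain ⟨M, hM0, hM⟩ := hφ.exists_norm_le
  refine ⟨|K| * M * volume.real (Metric.ball (0 : E) 1), fun x s hs => ?_⟩
  rw [← scaleAverage_sub hg hφ h0 hs x (g x)]
  refine (norm_scaleAverage_le (A := |K| * s ^ α) hs hφ hM fun y hy => ?_).trans_eq ?_
  · rw [abs_sub_comm]
    refine (hK x y).trans ?_
    have := le_abs_self K
    gcongr
  · rw [Real.rpow_add hs, Real.rpow_natCast]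
    ring

/-! ### The Newton kernel as a superposition of bumps -/

/-- The profile of a radial bump, as a function of the radius. -/
noncomputable def bumpProfile (r : ℝ) : ℝ := Real.smoothTransition (1 - r ^ 2)

theorem bumpProfile_eq_zero {r : ℝ} (hr : 1 ≤ r) : bumpProfile r = 0 :=
  Real.smoothTransition.zero_of_nonpos (by nlinarith)

theorem continuous_bumpProfile : Continuous bumpProfile :=
  Real.smoothTransition.continuous.comp (by fun_prop)

theorem isUnitBump_bumpProfile_norm {E : Type*} [NormedAddCommGroup E] [InnerProductSpace ℝ E] :
    IsUnitBump fun z : E => bumpProfile ‖z‖ where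
  contDiff := Real.smoothTransition.contDiff.comp (contDiff_const.sub (contDiff_norm_sq ℝ))
  eq_zero _ hz := bumpProfile_eq_zero hz.le

/-- The constant `c` with `∫₀^∞ s ^ (-q) η(r / s) ds = c r ^ (1 - q)`, for the bump profile `η`. -/
noncomputable def bumpConst (q : ℝ) : ℝ := ∫ s in Ioi (0 : ℝ), s ^ (-q) * bumpProfile s⁻¹

theorem bumpConst_pos {q : ℝ} (hq : 1 < q) : 0 < bumpConst q := by
  have hnn (s : ℝ) (hs : 0 < s) : 0 ≤ s ^ (-q) * bumpProfile s⁻¹ :=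
    mul_nonneg (Real.rpow_nonneg hs.le _) (Real.smoothTransition.nonneg _)
  have hint : IntegrableOn (fun s : ℝ => s ^ (-q) * bumpProfile s⁻¹) (Ioi 0) := by
    refine (integrableOn_and_norm_integral_le_of_twoScale (A := 1) (R := 1) (γ := 1)
      (p := q - 1) ?_ one_pos one_pos (sub_pos.2 hq) fun s hs => ?_).1
    · have := continuous_bumpProfile.measurable
      exact Measurable.aestronglyMeasurable (by fun_prop)
    · rw [Real.norm_of_nonneg (hnn s hs), one_mul, twoScale]
      split_ifs with h1
      · rw [bumpProfile_eq_zero (one_le_inv_iff₀.2 ⟨hs, h1⟩), mul_zero]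
        positivity
      · rw [show -1 - (q - 1) = -q by ring]
        exact mul_le_of_le_one_right (by positivity) (Real.smoothTransition.le_one _)
  rw [bumpConst, setIntegral_pos_iff_support_of_nonneg_ae
    ((ae_restrict_iff' measurableSet_Ioi).2 (.of_forall hnn)) hint]
  refine lt_of_lt_of_le ?_ (measure_mono (s := Ioi (1 : ℝ)) fun s (hs : 1 < s) => ⟨?_, ?_⟩)
  · simp
  · have hs0 : 0 < s := one_pos.trans hs
    have : s⁻¹ < 1 := inv_lt_one_of_one_lt₀ hs
    have : 0 < s⁻¹ := inv_pos.2 hs0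
    exact (mul_pos (Real.rpow_pos_of_pos hs0 _)
      (Real.smoothTransition.pos_of_pos (by nlinarith))).ne'
  · exact one_pos.trans hs

theorem integral_bumpProfile_div {q r : ℝ} (hr : 0 < r) :
    ∫ s in Ioi (0 : ℝ), s ^ (-q) * bumpProfile (s⁻¹ * r) = bumpConst q * r ^ (1 - q) := by
  have h := integral_comp_mul_left_Ioi (fun s : ℝ => s ^ (-q) * bumpProfile (s⁻¹ * r)) 0 hr
  rw [mul_zero, smul_eq_mul, eq_inv_mul_iff_mul_eq₀ hr.ne'] at h
  rw [← h, bumpConst, sub_eq_add_neg, Real.rpow_add hr, Real.rpow_one, mul_left_comm,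
    mul_comm _ (r ^ (-q)), ← integral_const_mul (r ^ (-q))]
  refine congrArg (r * ·) (setIntegral_congr_fun measurableSet_Ioi fun s (hs : 0 < s) => ?_)
  rw [Real.mul_rpow hr.le hs.le, mul_inv, mul_right_comm r⁻¹, inv_mul_cancel₀ hr.ne', one_mul,
    mul_assoc]

/-- Fubini's theorem turns the superposition of radial averages into a Riesz potential. -/
theorem integrable_and_scalePotential_bumpProfile [Nontrivial E] {δ C q γ : ℝ}
    (hg : Continuous g) (hδ : 0 < δ)
    (hC : ∀ x, |g x| ≤ C * (1 + ‖x‖) ^ (-(finrank ℝ E : ℝ) - δ)) (hq : 1 < q) (hγ : 0 < γ)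
    (hqγ : q + γ - 1 = finrank ℝ E) (x : E) :
    Integrable (fun y => g y * ‖x - y‖ ^ (1 - q)) ∧
      scalePotential g q (fun z : E => bumpProfile ‖z‖) x =
        bumpConst q * ∫ y, g y * ‖x - y‖ ^ (1 - q) := by
  have hφ : IsUnitBump fun z : E => bumpProfile ‖z‖ := isUnitBump_bumpProfile_norm
  set φ : E → ℝ := fun z => bumpProfile ‖z‖
  have hφ0 (z : E) : 0 ≤ φ z := Real.smoothTransition.nonneg _
  set G : ℝ → E → ℝ := fun s y => s ^ (-q) • (g y • φ (s⁻¹ • (x - y))) with hG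
  have hGm : StronglyMeasurable (Function.uncurry G) :=
    (Measurable.stronglyMeasurable (f := fun z : ℝ × E => z.1 ^ (-q)) (by fun_prop)).smul
      (stronglyMeasurable_scaleAverage_integrand hg hφ x)
  have hGint : Integrable (Function.uncurry G) ((volume.restrict (Ioi 0)).prod volume) := by
    rw [integrable_prod_iff hGm.aestronglyMeasurable]
    constructor
    · refine (ae_restrict_iff' measurableSet_Ioi).2 (.of_forall fun s (hs : 0 < s) => ?_)
      exact (integrable_scaleAverage_integrand hg hφ hs x).smul (s ^ (-q))
    · obtain ⟨A, hA⟩ := exists_scaleBound_of_decay (g := fun y => |g y|) hg.abs hδ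
        (fun x => by simpa using hC x) hφ hqγ
      refine (hA.integrableOn hg.abs hφ hq hγ x).congr_fun (fun s (hs : 0 < s) => ?_)
        measurableSet_Ioi
      simp only [scaleAverage, Function.uncurry, hG]
      rw [← integral_smul]
      refine integral_congr_ae (.of_forall fun y => ?_)
      simp only [smul_eq_mul, norm_mul, Real.norm_eq_abs, abs_of_nonneg (hφ0 _),
        abs_of_nonneg (Real.rpow_nonneg hs.le (-q))]
  -- The point `y = x`, where the kernel is singular and the scale integral diverges, is null.
  have hne : ∀ᵐ y : E, y ≠ x := by simp [ae_iff]
  have hinner : (fun y => ∫ s in Ioi (0 : ℝ), G s y) =ᵐ[volume]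
      fun y => bumpConst q * (g y * ‖x - y‖ ^ (1 - q)) := by
    filter_upwards [hne] with y hy
    rw [mul_left_comm, ← integral_bumpProfile_div (norm_pos_iff.2 (sub_ne_zero.2 hy.symm)),
      ← integral_const_mul]
    refine setIntegral_congr_fun measurableSet_Ioi fun s (hs : 0 < s) => ?_
    simp only [hG, φ, smul_eq_mul, norm_smul, norm_inv, Real.norm_of_nonneg hs.le]
    ring
  constructor
  · have h1 : Integrable fun y => ∫ s in Ioi (0 : ℝ), G s y := hGint.integral_prod_right
    have h2 := (h1.congr hinner).const_mul (bumpConst q)⁻¹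
    simpa only [inv_mul_cancel_left₀ (bumpConst_pos hq).ne'] using h2
  · rw [← integral_const_mul, ← integral_congr_ae hinner, ← integral_integral_swap hGint]
    simp only [scalePotential, scaleAverage, hG, integral_smul]

end

/-! ### Partial derivatives up to second order -/

theorem exists_multiDeriv_eq_foldr {n : ℕ} (σ : Fin n → ℕ) :
    ∃ m : List (Fin n), m.length = ∑ i, σ i ∧
      ∀ f, multiDeriv σ f = m.foldr (fun i h => partialDeriv i h) f := by
  refine ⟨(List.finRange n).flatMap fun i => List.replicate (σ i) i, ?_, fun f => ?_⟩
  · simp [List.length_flatMap, Fin.sum_univ_def]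
  · rw [multiDeriv, List.foldr_flatMap]
    congr 1
    funext i h
    induction σ i with
    | zero => rfl
    | succ k ih => rw [Function.iterate_succ_apply', ih, List.replicate_succ, List.foldr_cons]

theorem partialDeriv_eq {n : ℕ} {f : EuclideanSpace ℝ (Fin n) → ℝ}
    {f' : EuclideanSpace ℝ (Fin n) → EuclideanSpace ℝ (Fin n) →L[ℝ] ℝ}
    (hf : ∀ x, HasFDerivAt f (f' x) x) (i : Fin n) :
    partialDeriv i f = fun x => f' x (EuclideanSpace.single i 1) :=
  funext fun x => ((hf x).hasLineDerivAt _).lineDeriv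

theorem partialDeriv_partialDeriv_eq {n : ℕ} {f : EuclideanSpace ℝ (Fin n) → ℝ}
    {f' : EuclideanSpace ℝ (Fin n) → EuclideanSpace ℝ (Fin n) →L[ℝ] ℝ}
    {f'' : EuclideanSpace ℝ (Fin n) →
      EuclideanSpace ℝ (Fin n) →L[ℝ] EuclideanSpace ℝ (Fin n) →L[ℝ] ℝ}
    (hf : ∀ x, HasFDerivAt f (f' x) x) (hf' : ∀ x, HasFDerivAt f' (f'' x) x) (i j : Fin n) :
    partialDeriv i (partialDeriv j f) =
      fun x => f'' x (EuclideanSpace.single i 1) (EuclideanSpace.single j 1) := by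
  rw [partialDeriv_eq hf j]
  refine (partialDeriv_eq (f' := fun x => (f'' x).flip (EuclideanSpace.single j 1))
    (fun x => ?_) i).trans rfl
  refine ((hf' x).clm_apply (hasFDerivAt_const _ x)).congr_fderiv ?_
  ext v
  simp

theorem norm_clm_apply_single_le {n : ℕ} {F : Type*} [NormedAddCommGroup F] [NormedSpace ℝ F]
    (L : EuclideanSpace ℝ (Fin n) →L[ℝ] F) (i : Fin n) :
    ‖L (EuclideanSpace.single i 1)‖ ≤ ‖L‖ := by
  simpa using L.le_opNorm (EuclideanSpace.single i 1)

/-- A pointwise bound on the Fréchet derivatives of order `k ≤ 2` bounds the `D^σ f`, `|σ| = k`. -/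
theorem exists_abs_multiDeriv_le {n : ℕ} {f : EuclideanSpace ℝ (Fin n) → ℝ}
    {f' : EuclideanSpace ℝ (Fin n) → EuclideanSpace ℝ (Fin n) →L[ℝ] ℝ}
    {f'' : EuclideanSpace ℝ (Fin n) →
      EuclideanSpace ℝ (Fin n) →L[ℝ] EuclideanSpace ℝ (Fin n) →L[ℝ] ℝ}
    (hf : ∀ x, HasFDerivAt f (f' x) x) (hf' : ∀ x, HasFDerivAt f' (f'' x) x)
    {p B₀ B₁ B₂ : ℝ} (h₀ : ∀ x, ‖f x‖ ≤ B₀ * (1 + ‖x‖) ^ (p - (0 : ℕ)))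
    (h₁ : ∀ x, ‖f' x‖ ≤ B₁ * (1 + ‖x‖) ^ (p - (1 : ℕ)))
    (h₂ : ∀ x, ‖f'' x‖ ≤ B₂ * (1 + ‖x‖) ^ (p - (2 : ℕ))) :
    ∃ B, ∀ σ : Fin n → ℕ, ∑ i, σ i ≤ 2 → ∀ x,
      |multiDeriv σ f x| ≤ B * (1 + ‖x‖) ^ (p - ((∑ i, σ i : ℕ) : ℝ)) := by
  have hmono {B : ℝ} (hB : B ≤ max B₀ (max B₁ B₂)) (e : ℝ) (x : EuclideanSpace ℝ (Fin n)) :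
      B * (1 + ‖x‖) ^ e ≤ max B₀ (max B₁ B₂) * (1 + ‖x‖) ^ e := by
    gcongr
  refine ⟨max B₀ (max B₁ B₂), fun σ hσ x => ?_⟩
  obtain ⟨m, hm, hmσ⟩ := exists_multiDeriv_eq_foldr σ
  rw [hmσ, ← hm]
  rw [← hm] at hσ
  match m, hσ with
  | [], _ => exact (h₀ x).trans (hmono (le_max_left _ _) _ x)
  | [i], _ =>
    rw [List.foldr_cons, List.foldr_nil, partialDeriv_eq hf]
    exact (norm_clm_apply_single_le _ _).trans ((h₁ x).trans
      (hmono ((le_max_left _ _).trans (le_max_right _ _)) _ x))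
  | [i, j], _ =>
    rw [List.foldr_cons, List.foldr_cons, List.foldr_nil, partialDeriv_partialDeriv_eq hf hf']
    exact (norm_clm_apply_single_le _ _).trans ((norm_clm_apply_single_le _ _).trans ((h₂ x).trans
      (hmono ((le_max_right _ _).trans (le_max_right _ _)) _ x)))

theorem isCHolder_two {n : ℕ} {f : EuclideanSpace ℝ (Fin n) → ℝ}
    {f' : EuclideanSpace ℝ (Fin n) → EuclideanSpace ℝ (Fin n) →L[ℝ] ℝ}
    {f'' : EuclideanSpace ℝ (Fin n) →
      EuclideanSpace ℝ (Fin n) →L[ℝ] EuclideanSpace ℝ (Fin n) →L[ℝ] ℝ}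
    (hf : ∀ x, HasFDerivAt f (f' x) x) (hf' : ∀ x, HasFDerivAt f' (f'' x) x)
    {α B : ℝ≥0} (hα : 0 < α) (hB : HolderWith B α f'') : IsCHolder 2 α f := by
  refine ⟨?_, fun σ hσ => ?_⟩
  · have h1 : ContDiff ℝ ((1 : ℕ) + 1) f := contDiff_succ_iff_hasFDerivAt.2
      ⟨f', by exact_mod_cast contDiff_one_iff_hasFDerivAt.2 ⟨f'', hB.continuous hα, hf'⟩, hf⟩
    exact_mod_cast h1
  · obtain ⟨m, hm, hmσ⟩ := exists_multiDeriv_eq_foldr σ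
    rw [hmσ]
    rw [hσ] at hm
    obtain ⟨i, j, rfl⟩ := List.length_eq_two.1 hm
    rw [List.foldr_cons, List.foldr_cons, List.foldr_nil, partialDeriv_partialDeriv_eq hf hf']
    refine ⟨B, fun x y => le_trans ?_ (hB x y)⟩
    rw [edist_dist, edist_dist, dist_eq_norm, dist_eq_norm]
    exact ENNReal.ofReal_le_ofReal ((norm_clm_apply_single_le (f'' x - f'' y) i).trans'
      (norm_clm_apply_single_le ((f'' x - f'' y) (EuclideanSpace.single i 1)) j))

theorem holderWith_of_norm_sub_le {E F : Type*} [NormedAddCommGroup E] [NormedAddCommGroup F]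
    {f : E → F} {α : ℝ≥0} {B : ℝ} (hB : 0 ≤ B)
    (h : ∀ x y, ‖f x - f y‖ ≤ B * ‖x - y‖ ^ (α : ℝ)) : HolderWith B.toNNReal α f := by
  intro x y
  rw [edist_dist, edist_dist, dist_eq_norm, dist_eq_norm,
    ENNReal.ofReal_rpow_of_nonneg (norm_nonneg _) α.coe_nonneg,
    show ((B.toNNReal : ℝ≥0) : ENNReal) = ENNReal.ofReal B from rfl, ← ENNReal.ofReal_mul hB]
  exact ENNReal.ofReal_le_ofReal (h x y)

/-! ### The Newton potential -/

theorem AxiallySymmetric.newtonPotential {n : ℕ} {g : EuclideanSpace ℝ (Fin n) → ℝ}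
    (hg : AxiallySymmetric g) : AxiallySymmetric (newtonPotential g) := by
  intro R hR x
  simp only [_root_.newtonPotential]
  rw [← R.measurePreserving.integral_comp R.toHomeomorph.measurableEmbedding]
  simp only [hg R hR, ← map_sub, R.norm_map]

theorem lemma5p1 (n : ℕ) (hn : 3 ≤ n) (α : ℝ≥0) (hα0 : 0 < α) (hα1 : α < 1)
    (δ : ℝ) (hδ0 : 0 < δ) (hδ1 : δ < 1)
    (g : EuclideanSpace ℝ (Fin n) → ℝ) (hg : IsCHolder 0 α g)
    (C : ℝ) (hC : ∀ x, |g x| ≤ C * (1 + ‖x‖) ^ (-(n : ℝ) - δ)) :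
    (∀ x : EuclideanSpace ℝ (Fin n),
      MeasureTheory.Integrable (fun y => g y / ‖x - y‖ ^ (n - 2))) ∧
    IsCHolder 2 α (newtonPotential g) ∧
    (∃ C' : ℝ, ∀ σ : Fin n → ℕ, ∑ i, σ i ≤ 2 → ∀ x : EuclideanSpace ℝ (Fin n),
      |multiDeriv σ (newtonPotential g) x| ≤
        C' * (1 + ‖x‖) ^ (2 - (n : ℝ) - ((∑ i, σ i : ℕ) : ℝ))) ∧
    (AxiallySymmetric g → AxiallySymmetric (newtonPotential g)) := by
  have hn' : (3 : ℝ) ≤ n := by exact_mod_cast hn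
  have : NeZero n := ⟨by omega⟩
  have hfr : finrank ℝ (EuclideanSpace ℝ (Fin n)) = n := finrank_euclideanSpace_fin
  have hgc : Continuous g := hg.1.continuous
  obtain ⟨K, hK⟩ : MemHolder α g := by
    simpa [multiDeriv] using hg.2 0 (by simp)
  have hK' (x y : EuclideanSpace ℝ (Fin n)) : |g x - g y| ≤ K * ‖x - y‖ ^ (α : ℝ) := by
    simpa only [dist_eq_norm, Real.norm_eq_abs] using hK.dist_le x y
  have hCE : ∀ x, |g x| ≤
      C * (1 + ‖x‖) ^ (-(finrank ℝ (EuclideanSpace ℝ (Fin n)) : ℝ) - δ) := by rwa [hfr]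
  set φ : EuclideanSpace ℝ (Fin n) → ℝ := fun z => bumpProfile ‖z‖
  have hφ : IsUnitBump φ := isUnitBump_bumpProfile_norm
  -- Bounds on the averages against `φ`, `Dφ`, `D²φ` and `D³φ`.
  obtain ⟨A₀, h₀⟩ := exists_scaleBound_of_decay hgc hδ0 hCE hφ (q := n - 1) (γ := 2)
    (by rw [hfr]; ring)
  obtain ⟨A₁, h₁⟩ := exists_scaleBound_of_decay hgc hδ0 hCE hφ.fderiv (q := n - 1 + 1) (γ := 1)
    (by rw [hfr]; ring)
  obtain ⟨γ, A₂, hγ, h₂⟩ := exists_scaleBound_of_decay_of_integral_eq_zero hgc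
    (NNReal.coe_pos.2 hα0) hδ0 hCE hK' hφ.fderiv.fderiv (integral_fderiv_eq_zero hφ.fderiv)
  obtain ⟨H₂, hH₂⟩ := exists_norm_scaleAverage_le_of_holder hgc α.coe_nonneg hK'
    hφ.fderiv.fderiv (integral_fderiv_eq_zero hφ.fderiv)
  obtain ⟨H₃, hH₃⟩ := exists_norm_scaleAverage_le_of_holder hgc α.coe_nonneg hK'
    hφ.fderiv.fderiv.fderiv (integral_fderiv_eq_zero hφ.fderiv.fderiv)
  rw [hfr, show (n : ℝ) + 1 = n - 1 + 1 + 1 by ring] at h₂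
  -- The superpositions of these averages are the successive derivatives of the potential.
  have hD₁ := h₀.hasFDerivAt_scalePotential h₁ hgc hφ (by linarith) two_pos one_pos
  have hD₂ := h₁.hasFDerivAt_scalePotential h₂ hgc hφ.fderiv (by linarith) one_pos hγ
  obtain ⟨B₀, hB₀⟩ := h₀.exists_norm_scalePotential_le hgc hφ (by linarith) two_pos
  obtain ⟨B₁, hB₁⟩ := h₁.exists_norm_scalePotential_le hgc hφ.fderiv (by linarith) one_pos
  obtain ⟨B₂, hB₂⟩ := h₂.exists_norm_scalePotential_le hgc hφ.fderiv.fderiv (by linarith) hγ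
  have hbd {F : Type} [NormedAddCommGroup F] (v : F) (H H' s : ℝ) (hs : 0 < s)
      (hH : H ≤ H')
      (hv : ‖v‖ ≤ H * s ^ ((finrank ℝ (EuclideanSpace ℝ (Fin n)) : ℝ) + α)) :
      ‖v‖ ≤ H' * s ^ ((n : ℝ) - 1 + 1 + 1 - 1 + α) := by
    rw [hfr] at hv
    rw [show (n : ℝ) - 1 + 1 + 1 - 1 + α = n + α by ring]
    exact hv.trans (by gcongr)
  obtain ⟨B, hB, hBH⟩ := exists_norm_scalePotential_sub_le (q := n - 1 + 1 + 1)
    (A := max H₂ H₃) (α := α) hgc hφ.fderiv.fderiv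
    (NNReal.coe_pos.2 hα0) (by exact_mod_cast hα1)
    (fun x s hs => hbd _ H₂ _ s hs (le_max_left _ _) (hH₂ x s hs))
    (fun x s hs => hbd _ H₃ _ s hs (le_max_right _ _) (hH₃ x s hs))
    (h₂.integrableOn hgc hφ.fderiv.fderiv (by linarith) hγ)
  have hker (r : ℝ) (hr : 0 ≤ r) : r ^ (1 - ((n : ℝ) - 1)) = (r ^ (n - 2))⁻¹ := by
    rw [← Real.rpow_natCast, ← Real.rpow_neg hr, Nat.cast_sub (by omega)]
    congr 1
    push_cast
    ring
  have hfub := integrable_and_scalePotential_bumpProfile hgc hδ0 hCE (q := n - 1) (γ := 2)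
    (by linarith) two_pos (by rw [hfr]; ring)
  simp only [hker _ (norm_nonneg _), ← div_eq_mul_inv] at hfub
  have hc := bumpConst_pos (q := (n : ℝ) - 1) (by linarith)
  set a := -(bumpConst ((n : ℝ) - 1))⁻¹ with ha
  have hU : newtonPotential g = fun x => a • scalePotential g (n - 1) φ x := by
    funext x
    rw [(hfub x).2, ha, smul_eq_mul, neg_mul, inv_mul_cancel_left₀ hc.ne']
    rfl
  have hU₁ (x) := (hD₁ x).const_smul a
  have hU₂ (x) := (hD₂ x).const_smul a
  have hbound {F : Type} [NormedAddCommGroup F] [NormedSpace ℝ F] {v : F} {B e e' r : ℝ}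
      (hv : ‖v‖ ≤ B * r ^ e) (he : e = e') : ‖a • v‖ ≤ |a| * B * r ^ e' := by
    rw [norm_smul, mul_assoc, ← he]
    exact mul_le_mul_of_nonneg_left hv (abs_nonneg a)
  refine ⟨fun x => (hfub x).1, ?_, ?_, AxiallySymmetric.newtonPotential⟩
  · rw [hU]
    refine isCHolder_two hU₁ hU₂ hα0 (holderWith_of_norm_sub_le (B := |a| * B) (by positivity)
      fun x y => ?_)
    exact (congrArg norm (smul_sub a _ _).symm).trans_le (hbound (hBH x y) rfl)
  · rw [hU]
    exact exists_abs_multiDeriv_le hU₁ hU₂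
      (fun x => hbound (hB₀ x) (by push_cast; ring))
      (fun x => hbound (hB₁ x) (by push_cast; ring))
      (fun x => hbound (hB₂ x) (by push_cast; ring))
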